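/- Let $L\ge 4$ be an even integer. Let $\mathcal X$ be the $L\times L$ square lattice on the torus (the lattice of the $[[2L^2,2,L]]$ toric code): its vertices are the elements $(i,j)$ of $(\mathbb Z/L)^2$, its $2L^2$ edges join $(i,j)$ to $(i+1,j)$ and $(i,j)$ to $(i,j+1)$, and its plaquettes are the $L^2$ unit squares. Let $\mathcal X^*$ be the dual lattice: its vertices are the plaquettes of $\mathcal X$, its edges are the edges of $\mathcal X$, each joining the two plaquettes that share it, and its plaquettes are the vertices of $\mathcal X$, the boundary of the plaquette corresponding to a vertex $v$ consisting of the four edges at $v$. Let $G=(V,E)$ be the graph of $\mathcal X$ or of $\mathcal X^*$. For $J\subseteq E$ and $v\in V$, the $J$-degree of $v$ is the number of edges of $J$ incident to $v$. For $D\subseteq V$, a $D$-join is a set $J\subseteq E$ such that the $J$-degree of every vertex in $D$ is odd and the $J$-degree of every vertex in $V\setminus D$ is even. A $2$-chain $c$ is a formal $\mathbb F_2$-linear combination of plaquettes of the lattice considered, and $\partial c$ is the $\mathbb F_2$-sum of the boundaries of the plaquettes in $c$ (the boundary of a plaquette being the sum of its four edges), regarded as a set of edges; $\oplus$ denotes symmetric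 difference. **Theorem.** Let $D\subseteq V$ have even cardinality. Then $G$ has a minimum-size $D$-join $J$ such that every vertex in $D$ has $J$-degree $1$. More specifically, for every minimum-size $D$-join $J$ of $G$ there exists a $2$-chain $c$ such that $J'=J\oplus\partial c$ is a $D$-join with $|J'|=|J|$ and every vertex in $D$ has $J'$-degree $1$. -/

import Mathlib

open scoped symmDiff

namespace ToricCode

section Joins

variable {V E : Type*}

/-- The `J`-degree of `v` in `G`: the number of edges of `J` incident to `v`
(all the graphs below are loopless for side length at least `2`). -/
noncomputable def joinDegree (G : Graph V E) (J : Finset E) (v : V) : ℕ :=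
  {e : E | e ∈ J ∧ G.Inc e v}.ncard

/-- `J` is a `D`-join of `G`: a set of edges of `G` such that the `J`-degree of each vertex in `D`
is odd and the `J`-degree of each other vertex of `G` is even. -/
def IsDJoin (G : Graph V E) (D : Finset V) (J : Finset E) : Prop :=
  (∀ e ∈ J, e ∈ G.edgeSet) ∧
    (∀ v ∈ D, Odd (joinDegree G J v)) ∧
    ∀ v ∈ G.vertexSet, v ∉ D → Even (joinDegree G J v)

/-- `J` is a `D`-join of `G` of minimum size among all `D`-joins of `G`. -/
def IsMinDJoin (G : Graph V E) (D : Finset V) (J : Finset E) : Prop :=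
  IsDJoin G D J ∧ ∀ K : Finset E, IsDJoin G D K → J.card ≤ K.card

end Joins

section Chains

variable {E F : Type*} [Fintype E] [DecidableEq E] [Fintype F]

/-- The boundary map `∂₂` on chains over `𝔽₂`, where `sides f` is the set of edges of the 2-cell
`f`: the linear extension of the map sending each 2-cell to the sum of its edges. -/
def boundary (sides : F → Finset E) : (F → ZMod 2) →ₗ[ZMod 2] (E → ZMod 2) :=
  Fintype.linearCombination (ZMod 2) fun f => ∑ e ∈ sides f, Pi.single e 1

/-- The set of edges in the support of a 1-chain over `𝔽₂`. -/
def chainSupport (x : E → ZMod 2) : Finset E :=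
  Finset.univ.filter fun e => x e ≠ 0

/-- `J ⊕ ∂c`, for an edge set `J` and a 2-chain `c`. -/
def xorBoundary (sides : F → Finset E) (J : Finset E) (c : F → ZMod 2) : Finset E :=
  J ∆ chainSupport (boundary sides c)

end Chains

/-- Vertices of the `L × L` square lattice on the torus. -/
abbrev Vertex (L : ℕ) : Type := ZMod L × ZMod L

/-- Plaquettes (unit squares) of the lattice; `(i, j)` is the square with corners
`(i, j)`, `(i + 1, j)`, `(i + 1, j + 1)`, `(i, j + 1)`. -/
abbrev Plaquette (L : ℕ) : Type := ZMod L × ZMod L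

/-- The `2 L²` edges of the lattice: `Sum.inl (i, j)` is the horizontal edge from `(i, j)` to
`(i + 1, j)`, and `Sum.inr (i, j)` is the vertical edge from `(i, j)` to `(i, j + 1)`. -/
abbrev Edge (L : ℕ) : Type := (ZMod L × ZMod L) ⊕ (ZMod L × ZMod L)

/-- The two endpoints of an edge. -/
def ends (L : ℕ) : Edge L → Finset (Vertex L)
  | Sum.inl (i, j) => {(i, j), (i + 1, j)}
  | Sum.inr (i, j) => {(i, j), (i, j + 1)}

/-- The four sides of a plaquette: bottom, top, left, right. -/
def sides (L : ℕ) : Plaquette L → Finset (Edge L)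
  | (i, j) => {Sum.inl (i, j), Sum.inl (i, j + 1), Sum.inr (i, j), Sum.inr (i + 1, j)}

/-- The four edges at a vertex. These are the sides of the corresponding 2-cell of the dual
lattice. -/
def dualSides (L : ℕ) [NeZero L] (v : Vertex L) : Finset (Edge L) :=
  Finset.univ.filter fun e => v ∈ ends L e

/-- The graph of the toric code lattice: an edge joins its two distinct endpoints. -/
def lattice (L : ℕ) : Graph (Vertex L) (Edge L) where
  vertexSet := Set.univ
  IsLink e u v := u ≠ v ∧ u ∈ ends L e ∧ v ∈ ends L e
  isLink_symm _ _ := ⟨fun _ _ h => ⟨h.1.symm, h.2.2, h.2.1⟩⟩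
  eq_or_eq_of_isLink_of_isLink := by
    rintro (⟨i, j⟩ | ⟨i, j⟩) x y v w h h' <;>
    · simp only [ends, Finset.mem_insert, Finset.mem_singleton] at h h'
      grind
  left_mem_of_isLink _ _ _ _ := Set.mem_univ _

/-- The graph of the dual lattice: its vertices are the plaquettes, its edges are identified with
the edges of the lattice, and an edge joins the two distinct plaquettes that share it. -/
def dualLattice (L : ℕ) : Graph (Plaquette L) (Edge L) where
  vertexSet := Set.univ
  IsLink e p q := p ≠ q ∧ e ∈ sides L p ∧ e ∈ sides L q
  isLink_symm _ _ := ⟨fun _ _ h => ⟨h.1.symm, h.2.2, h.2.1⟩⟩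
  eq_or_eq_of_isLink_of_isLink := by
    rintro (⟨i, j⟩ | ⟨i, j⟩) ⟨x, x'⟩ ⟨y, y'⟩ ⟨v, v'⟩ ⟨w, w'⟩ h h' <;>
    · simp only [sides, Finset.mem_insert, Finset.mem_singleton, Sum.inl.injEq, Sum.inr.injEq,
        reduceCtorEq, or_false, false_or, Prod.mk.injEq, ne_eq] at h h' ⊢
      grind
  left_mem_of_isLink _ _ _ _ := Set.mem_univ _

end ToricCode

namespace ToricCode

/-! Among the minimum joins differing from the given one by boundaries, take one with fewest excess
vertices, that is, vertices of `D` of degree 3. Suppose there is one. The four edges at a vertex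
form two corner pairs, each spanning an outgoing plaquette, so an excess vertex has a full pair.
Flipping that plaquette trades this pair for the two opposite sides: the size is unchanged and two
units of degree move to the opposite corner. As the number of excess vertices cannot drop, that
corner is now an excess vertex of `D`, and the process continues forever.

Outgoing plaquettes are chosen by column parity so that an arrival adds one edge to each pair of the
corner reached. Hence a vertex revisited must be left through the other pair
(`IsWalk.exits_alternate`), and a vertex visited infinitely often passes this on to both its
targets. The walk thus covers a whole chessboard colour class (`IsWalk.visits_colour_class`), which
therefore lies in `D`.

Every edge has one end in that class, so the join has more than `L * L / 2` edges. But a Hamiltonian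
cycle contains two complementary `D`-joins, one of which has at most `L * L / 2` edges
(`exists_isJoin_card_le`): a contradiction. The dual lattice is isomorphic to the lattice, 2-cells
included. -/

/-- The number of edges of `J` at the vertex `v` of the lattice. -/
def degree {L : ℕ} (J : Finset (Edge L)) (v : Vertex L) : ℕ :=
  (J.filter fun e => v ∈ ends L e).card

/-- `D`-joins of the lattice, in terms of degrees modulo 2. -/
def IsJoin {L : ℕ} (D : Finset (Vertex L)) (J : Finset (Edge L)) : Prop :=
  ∀ v, (degree J v : ZMod 2) = if v ∈ D then 1 else 0

/-- `D`-joins of the lattice of minimum size. -/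
def IsMinJoin {L : ℕ} (D : Finset (Vertex L)) (J : Finset (Edge L)) : Prop :=
  IsJoin D J ∧ ∀ K, IsJoin D K → J.card ≤ K.card

/-! ### Outgoing plaquettes and the chessboard colouring -/

section Coordinates

variable {L : ℕ}

/-- Whether a column index is even. -/
def evenCol (i : ZMod L) : Bool := decide ((i.cast : ZMod 2) = 0)

/-- The colour of a vertex in the chessboard colouring. -/
def colour (x : Vertex L) : ZMod 2 := (x.1.cast : ZMod 2) + x.2.cast

/-- The horizontal edge at `x` on the side of the plaquette `outCell x τ`. -/
def hEdge (x : Vertex L) (τ : Bool) : Edge L :=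
  Sum.inl (if τ = evenCol x.1 then x.1 else x.1 - 1, x.2)

/-- The vertical edge at `x` on the side of the plaquette `outCell x τ`. -/
def vEdge (x : Vertex L) (τ : Bool) : Edge L :=
  Sum.inr (x.1, if τ then x.2 else x.2 - 1)

/-- The two plaquettes at `x` through which an excess may leave `x`: the north-east and south-west
ones in even columns, the north-west and south-east ones in odd columns. -/
def outCell (x : Vertex L) (τ : Bool) : Plaquette L :=
  (if τ = evenCol x.1 then x.1 else x.1 - 1, if τ then x.2 else x.2 - 1)

/-- The corner of `outCell x τ` opposite to `x`. -/
def target (x : Vertex L) (τ : Bool) : Vertex L :=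
  (if τ = evenCol x.1 then x.1 + 1 else x.1 - 1, if τ then x.2 + 1 else x.2 - 1)

lemma zmod_two_eq (a : ZMod 2) : a = 0 ∨ a = 1 := by
  revert a; decide

lemma evenCol_add_one (hL : Even L) (i : ZMod L) : evenCol (i + 1) = !evenCol i := by
  unfold evenCol
  rw [ZMod.cast_add hL.two_dvd, ZMod.cast_one hL.two_dvd]
  rcases zmod_two_eq (i.cast : ZMod 2) with h | h <;> rw [h] <;> decide

lemma evenCol_sub_one (hL : Even L) (i : ZMod L) : evenCol (i - 1) = !evenCol i := by
  have := evenCol_add_one hL (i - 1)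
  rw [sub_add_cancel] at this
  simp [this]

/-- Opposite corners lie in columns of opposite parity, which needs `L` even. Hence the two sides at
the target carry different labels `τ` and `!τ`: an arrival meets each outgoing pair in one edge. -/
lemma sides_outCell (hL : Even L) (x : Vertex L) (τ : Bool) :
    sides L (outCell x τ) =
      {hEdge x τ, vEdge x τ, hEdge (target x τ) τ, vEdge (target x τ) (!τ)} := by
  obtain ⟨i, j⟩ := x
  ext e
  cases τ <;> cases h : evenCol i <;>
    simp [sides, outCell, hEdge, vEdge, target, h, evenCol_add_one hL, evenCol_sub_one hL] <;> tauto

lemma mem_ends_iff (v : Vertex L) (e : Edge L) :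
    v ∈ ends L e ↔ ∃ τ, e = hEdge v τ ∨ e = vEdge v τ := by
  obtain ⟨i, j⟩ := v
  obtain ⟨a, b⟩ | ⟨a, b⟩ := e <;> cases h : evenCol i <;>
    simp [ends, hEdge, vEdge, h, eq_sub_iff_add_eq, eq_comm] <;> tauto

lemma one_ne_zero_zmod (hL4 : 4 ≤ L) : (1 : ZMod L) ≠ 0 := by
  have : Fact (1 < L) := ⟨by omega⟩
  exact one_ne_zero

lemma colour_target (hL : Even L) (x : Vertex L) (τ : Bool) : colour (target x τ) = colour x := by
  have h1 := ZMod.cast_one (R := ZMod 2) hL.two_dvd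
  obtain ⟨i, j⟩ := x
  cases τ <;> cases h : evenCol i <;>
    simp [colour, target, h, ZMod.cast_add hL.two_dvd, ZMod.cast_sub hL.two_dvd, h1] <;>
    generalize (i.cast : ZMod 2) = a <;> generalize (j.cast : ZMod 2) = b <;> revert a b <;> decide

lemma colour_fst_add_one (hL : Even L) (i j : ZMod L) : colour (i + 1, j) = colour (i, j) + 1 := by
  have h1 := ZMod.cast_one (R := ZMod 2) hL.two_dvd
  simp [colour, ZMod.cast_add hL.two_dvd, h1]; ring

lemma colour_snd_add_one (hL : Even L) (i j : ZMod L) : colour (i, j + 1) = colour (i, j) + 1 := by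
  have h1 := ZMod.cast_one (R := ZMod 2) hL.two_dvd
  simp [colour, ZMod.cast_add hL.two_dvd, h1]; ring

/-- Each edge has exactly one end of each colour. -/
lemma eq_of_mem_ends (hL : Even L) {x y : Vertex L} {e : Edge L} (hx : x ∈ ends L e)
    (hy : y ∈ ends L e) (h : colour x = colour y) : x = y := by
  have key : ∀ a : ZMod 2, a + 1 ≠ a := by decide
  obtain ⟨a, b⟩ | ⟨a, b⟩ := e <;> simp only [ends, Finset.mem_insert, Finset.mem_singleton] at hx hy
  · have := colour_fst_add_one hL a b
    rcases hx with rfl | rfl <;> rcases hy with rfl | rfl <;> simp_all [eq_comm]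
  · have := colour_snd_add_one hL a b
    rcases hx with rfl | rfl <;> rcases hy with rfl | rfl <;> simp_all [eq_comm]

lemma exists_mem_ends (hL : Even L) (κ : ZMod 2) (e : Edge L) : ∃ x ∈ ends L e, colour x = κ := by
  have key : ∀ a b : ZMod 2, a = b ∨ a + 1 = b := by decide
  obtain ⟨a, b⟩ | ⟨a, b⟩ := e
  · rcases key (colour (a, b)) κ with h | h
    · exact ⟨(a, b), by simp [ends], h⟩
    · exact ⟨(a + 1, b), by simp [ends], by rw [colour_fst_add_one hL, h]⟩
  · rcases key (colour (a, b)) κ with h | h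
    · exact ⟨(a, b), by simp [ends], h⟩
    · exact ⟨(a, b + 1), by simp [ends], by rw [colour_snd_add_one hL, h]⟩

lemma hEdge_mem (x : Vertex L) (τ : Bool) : x ∈ ends L (hEdge x τ) :=
  (mem_ends_iff _ _).2 ⟨τ, Or.inl rfl⟩

lemma vEdge_mem (x : Vertex L) (τ : Bool) : x ∈ ends L (vEdge x τ) :=
  (mem_ends_iff _ _).2 ⟨τ, Or.inr rfl⟩

lemma hEdge_inj (hL4 : 4 ≤ L) {x : Vertex L} {τ σ : Bool} (h : hEdge x τ = hEdge x σ) : τ = σ := by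
  have := one_ne_zero_zmod hL4
  obtain ⟨i, j⟩ := x
  revert h
  cases τ <;> cases σ <;> cases h : evenCol i <;> simp [hEdge, h, this, eq_sub_iff_add_eq]

lemma vEdge_inj (hL4 : 4 ≤ L) {x : Vertex L} {τ σ : Bool} (h : vEdge x τ = vEdge x σ) : τ = σ := by
  have := one_ne_zero_zmod hL4
  obtain ⟨i, j⟩ := x
  revert h
  cases τ <;> cases σ <;> simp [vEdge, this, eq_sub_iff_add_eq]

lemma hEdge_ne_vEdge (x y : Vertex L) (τ σ : Bool) : hEdge x τ ≠ vEdge y σ := by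
  simp [hEdge, vEdge]

lemma target_ne (hL4 : 4 ≤ L) (x : Vertex L) (τ : Bool) : target x τ ≠ x := by
  have := one_ne_zero_zmod hL4
  obtain ⟨i, j⟩ := x
  cases τ <;> simp [target, this]

/-- The two other corners of an outgoing plaquette lie on one edge at `x` and one edge at the
opposite corner each. -/
lemma ends_outCell (hL : Even L) (hL4 : 4 ≤ L) (x : Vertex L) (τ : Bool) : ∃ z w : Vertex L,
    (z ≠ x ∧ z ≠ target x τ ∧ w ≠ x ∧ w ≠ target x τ) ∧
    ends L (hEdge x τ) = {x, z} ∧ ends L (vEdge (target x τ) (!τ)) = {target x τ, z} ∧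
    ends L (vEdge x τ) = {x, w} ∧ ends L (hEdge (target x τ) τ) = {target x τ, w} := by
  have := one_ne_zero_zmod hL4
  refine ⟨((target x τ).1, x.2), (x.1, (target x τ).2), ?_⟩
  obtain ⟨i, j⟩ := x
  cases τ <;> cases h : evenCol i <;>
    simp [ends, hEdge, vEdge, target, h, evenCol_add_one hL, evenCol_sub_one hL, Finset.pair_comm,
      this, eq_sub_iff_add_eq]

end Coordinates

/-! ### Flipping a plaquette in a minimum join -/

section Flips

variable {L : ℕ}

lemma degree_insert {J : Finset (Edge L)} {e : Edge L} (he : e ∉ J) (v : Vertex L) :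
    degree (insert e J) v = degree J v + if v ∈ ends L e then 1 else 0 := by
  unfold degree
  rw [Finset.filter_insert]
  split_ifs with h
  · rw [Finset.card_insert_of_notMem (by simp [he])]
  · rfl

/-- The four sides of an outgoing plaquette are distinct. -/
lemma sides_outCell_distinct (hL : Even L) (hL4 : 4 ≤ L) (x : Vertex L) (τ : Bool) :
    (hEdge x τ ≠ hEdge (target x τ) τ ∧ vEdge x τ ≠ vEdge (target x τ) (!τ)) := by
  constructor
  · intro h
    have h1 := hEdge_mem x τ
    rw [h] at h1
    exact target_ne hL4 x τ
      (eq_of_mem_ends hL (hEdge_mem _ _) h1 (colour_target hL x τ))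
  · intro h
    have h1 := vEdge_mem x τ
    rw [h] at h1
    exact target_ne hL4 x τ
      (eq_of_mem_ends hL (vEdge_mem _ _) h1 (colour_target hL x τ))

lemma card_sides_outCell (hL : Even L) (hL4 : 4 ≤ L) (x : Vertex L) (τ : Bool) :
    (sides L (outCell x τ)).card = 4 := by
  obtain ⟨h1, h2⟩ := sides_outCell_distinct hL hL4 x τ
  rw [sides_outCell hL, Finset.card_insert_of_notMem, Finset.card_insert_of_notMem,
    Finset.card_insert_of_notMem, Finset.card_singleton] <;>
  simp [h1, h2, hEdge_ne_vEdge, (hEdge_ne_vEdge _ _ _ _).symm]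

lemma card_symmDiff_add {α : Type*} [DecidableEq α] (s t : Finset α) :
    (s ∆ t).card + 2 * (s ∩ t).card = s.card + t.card := by
  have h1 := Finset.card_sdiff_add_card_inter s t
  have h2 := Finset.card_sdiff_add_card_inter t s
  have h3 : (s ∆ t).card = (s \ t).card + (t \ s).card :=
    Finset.card_union_of_disjoint disjoint_sdiff_sdiff
  rw [Finset.inter_comm] at h2
  omega

lemma degree_symmDiff (J K : Finset (Edge L)) (v : Vertex L) :
    (degree (J ∆ K) v : ZMod 2) = degree J v + degree K v := by
  have h : (J ∆ K).filter (fun e => v ∈ ends L e) =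
      (J.filter fun e => v ∈ ends L e) ∆ (K.filter fun e => v ∈ ends L e) := by
    ext e; simp [Finset.mem_symmDiff]; tauto
  have h2 := congrArg (Nat.cast : ℕ → ZMod 2)
    (card_symmDiff_add (J.filter fun e => v ∈ ends L e) (K.filter fun e => v ∈ ends L e))
  unfold degree
  rw [h]
  push_cast at h2
  rwa [show (2 : ZMod 2) = 0 from rfl, zero_mul, add_zero] at h2

lemma degree_sides_outCell (hL : Even L) (hL4 : 4 ≤ L) (x : Vertex L) (τ : Bool) (v : Vertex L) :
    (degree (sides L (outCell x τ)) v : ZMod 2) = 0 := by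
  obtain ⟨h1, h2⟩ := sides_outCell_distinct hL hL4 x τ
  obtain ⟨z, w, ⟨hz, hz', hw, hw'⟩, e1, e2, e3, e4⟩ := ends_outCell hL hL4 x τ
  have ht := target_ne hL4 x τ
  have h0 : degree (∅ : Finset (Edge L)) v = 0 := by simp [degree]
  rw [sides_outCell hL, ← insert_empty_eq (vEdge (target x τ) (!τ)), degree_insert,
    degree_insert, degree_insert, degree_insert, e1, e2, e3, e4, h0]
  · simp only [Finset.mem_insert, Finset.mem_singleton]
    generalize target x τ = y at *
    by_cases hx : v = x <;> by_cases hy : v = y <;> by_cases hvz : v = z <;>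
      by_cases hvw : v = w <;> simp_all <;> decide
  all_goals simp [h1, h2, hEdge_ne_vEdge, (hEdge_ne_vEdge _ _ _ _).symm]

lemma IsJoin.flip (hL : Even L) (hL4 : 4 ≤ L) {D : Finset (Vertex L)} {J : Finset (Edge L)}
    (hJ : IsJoin D J) (x : Vertex L) (τ : Bool) : IsJoin D (J ∆ sides L (outCell x τ)) := by
  intro v
  rw [degree_symmDiff, degree_sides_outCell hL hL4, add_zero, hJ v]

/-- A minimum join contains at most two sides of a plaquette. -/
lemma IsMinJoin.card_inter_sides_le (hL : Even L) (hL4 : 4 ≤ L) {D : Finset (Vertex L)}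
    {J : Finset (Edge L)} (hJ : IsMinJoin D J) (x : Vertex L) (τ : Bool) :
    (J ∩ sides L (outCell x τ)).card ≤ 2 := by
  have h1 := hJ.2 _ (hJ.1.flip hL hL4 x τ)
  have h2 := card_symmDiff_add J (sides L (outCell x τ))
  have h3 := card_sides_outCell hL hL4 x τ
  omega

lemma IsMinJoin.notMem_of_mem (hL : Even L) (hL4 : 4 ≤ L) {D : Finset (Vertex L)}
    {J : Finset (Edge L)} (hJ : IsMinJoin D J) {x : Vertex L} {τ : Bool} (hh : hEdge x τ ∈ J)
    (hv : vEdge x τ ∈ J) : hEdge (target x τ) τ ∉ J ∧ vEdge (target x τ) (!τ) ∉ J := by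
  obtain ⟨h1, h2⟩ := sides_outCell_distinct hL hL4 x τ
  have hc := hJ.card_inter_sides_le hL hL4 x τ
  rw [sides_outCell hL] at hc
  have key (e : Edge L) (h3 : hEdge x τ ≠ e) (h4 : vEdge x τ ≠ e)
      (h5 : e = hEdge (target x τ) τ ∨ e = vEdge (target x τ) (!τ)) : e ∉ J := by
    intro he
    have hs : {hEdge x τ, vEdge x τ, e} ⊆ J ∩
        {hEdge x τ, vEdge x τ, hEdge (target x τ) τ, vEdge (target x τ) (!τ)} := by
      intro a ha
      simp only [Finset.mem_insert, Finset.mem_singleton] at ha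
      rcases ha with rfl | rfl | rfl
      · simp [hh]
      · simp [hv]
      · simp [he]; tauto
    have := Finset.card_le_card hs
    rw [Finset.card_eq_three.2 ⟨_, _, _, hEdge_ne_vEdge _ _ _ _, h3, h4, rfl⟩] at this
    omega
  exact ⟨key _ h1 (hEdge_ne_vEdge _ _ _ _).symm (Or.inl rfl),
    key _ (hEdge_ne_vEdge _ _ _ _) h2 (Or.inr rfl)⟩

/-- At least two of the four sides are in `J`, so the flip does not increase the size. -/
lemma IsMinJoin.flip (hL : Even L) (hL4 : 4 ≤ L) {D : Finset (Vertex L)} {J : Finset (Edge L)}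
    (hJ : IsMinJoin D J) {x : Vertex L} {τ : Bool} (hh : hEdge x τ ∈ J)
    (hv : vEdge x τ ∈ J) : IsMinJoin D (J ∆ sides L (outCell x τ)) := by
  refine ⟨hJ.1.flip hL hL4 x τ, fun K hK => le_trans ?_ (hJ.2 K hK)⟩
  have h2 := card_symmDiff_add J (sides L (outCell x τ))
  have h3 := card_sides_outCell hL hL4 x τ
  have h4 : 2 ≤ (J ∩ sides L (outCell x τ)).card := by
    rw [← Finset.card_pair (hEdge_ne_vEdge x x τ τ)]
    refine Finset.card_le_card fun e he => ?_
    simp only [Finset.mem_insert, Finset.mem_singleton] at he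
    rcases he with rfl | rfl <;> simp [hh, hv, sides_outCell hL]
  omega

lemma symmDiff_four {α : Type*} [DecidableEq α] {s : Finset α} {a b c d : α} (ha : a ∈ s)
    (hb : b ∈ s) (hc : c ∉ s) (hd : d ∉ s) :
    s ∆ {a, b, c, d} = insert c (insert d (s \ {a, b})) := by
  ext e
  simp only [Finset.mem_insert, Finset.mem_sdiff, Finset.mem_singleton, Finset.mem_symmDiff]
  by_cases hs : e ∈ s
  · have h1 : e ≠ c := fun h => hc (h ▸ hs)
    have h2 : e ≠ d := fun h => hd (h ▸ hs)
    simp [hs, h1, h2]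
  · have h1 : e ≠ a := fun h => hs (h ▸ ha)
    have h2 : e ≠ b := fun h => hs (h ▸ hb)
    simp [hs, h1, h2]

/-- Flipping an outgoing plaquette at `x` moves two units of degree from `x` to the opposite
corner and leaves the other degrees unchanged. -/
lemma IsMinJoin.degree_flip (hL : Even L) (hL4 : 4 ≤ L) {D : Finset (Vertex L)}
    {J : Finset (Edge L)} (hJ : IsMinJoin D J) {x : Vertex L} {τ : Bool} (hh : hEdge x τ ∈ J)
    (hv : vEdge x τ ∈ J) (v : Vertex L) :
    degree (J ∆ sides L (outCell x τ)) v + (if v = x then 2 else 0) =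
      degree J v + if v = target x τ then 2 else 0 := by
  obtain ⟨h1, h2⟩ := sides_outCell_distinct hL hL4 x τ
  obtain ⟨h3, h4⟩ := hJ.notMem_of_mem hL hL4 hh hv
  obtain ⟨z, w, ⟨hz, hz', hw, hw'⟩, e1, e2, e3, e4⟩ := ends_outCell hL hL4 x τ
  have ht := target_ne hL4 x τ
  have n1 := hEdge_ne_vEdge x x τ τ
  have n2 := hEdge_ne_vEdge x (target x τ) τ (!τ)
  have n3 := hEdge_ne_vEdge (target x τ) x τ τ
  have n4 := hEdge_ne_vEdge (target x τ) (target x τ) τ (!τ)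
  set K := J \ {hEdge x τ, vEdge x τ} with hK
  have hJK : J = insert (hEdge x τ) (insert (vEdge x τ) K) := by
    ext e; simp only [hK, Finset.mem_insert, Finset.mem_sdiff, Finset.mem_singleton]
    by_cases he : e = hEdge x τ <;> by_cases he' : e = vEdge x τ <;> simp_all
  have hJK' : J ∆ sides L (outCell x τ) =
      insert (hEdge (target x τ) τ) (insert (vEdge (target x τ) (!τ)) K) := by
    rw [sides_outCell hL, symmDiff_four hh hv h3 h4]
  have hK1 : vEdge x τ ∉ K := by simp [hK]
  have hK2 : hEdge x τ ∉ insert (vEdge x τ) K := by simp [hK, n1]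
  have hK3 : vEdge (target x τ) (!τ) ∉ K := by simp [hK, h4]
  have hK4 : hEdge (target x τ) τ ∉ insert (vEdge (target x τ) (!τ)) K := by simp [hK, h3, n4]
  rw [hJK', degree_insert hK4, degree_insert hK3]
  conv_rhs => rw [hJK, degree_insert hK2, degree_insert hK1]
  rw [e1, e2, e3, e4]
  clear_value K
  simp only [Finset.mem_insert, Finset.mem_singleton]
  generalize target x τ = y at *
  clear * - hz hz' hw hw' ht
  by_cases hx : v = x
  · subst hx; simp [hz.symm, hw.symm, ht.symm]
  by_cases hy : v = y
  · subst hy; simp [hz'.symm, hw'.symm, ht]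
  simp only [hx, hy, if_false, false_or]
  ring

end Flips

/-! ### A Hamiltonian cycle and the bound of half the vertices -/

section Hamiltonian

variable {L : ℕ}

/-- A Hamiltonian cycle of the lattice: `L` steps along each row, the last one replaced by a step
to the next row. -/
def cyclePoint (L k : ℕ) : Vertex L := ((k : ZMod L) - (k / L : ℕ), (k / L : ℕ))

/-- The edge of the Hamiltonian cycle between its points of index `k` and `k + 1`. -/
def cycleEdge (L k : ℕ) : Edge L :=
  if L ∣ k + 1 then Sum.inr (cyclePoint L k) else Sum.inl (cyclePoint L k)

lemma ends_cycleEdge (L k : ℕ) :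
    ends L (cycleEdge L k) = {cyclePoint L k, cyclePoint L (k + 1)} := by
  unfold cycleEdge
  split_ifs with h
  · simp [ends, cyclePoint, Nat.succ_div_of_dvd h]
  · simp only [ends, cyclePoint, Nat.succ_div_of_not_dvd h]
    push_cast
    congr 2
    ring_nf

lemma cyclePoint_succ_ne (hL4 : 4 ≤ L) (k : ℕ) :
    cyclePoint L k ≠ cyclePoint L (k + 1) := by
  have := one_ne_zero_zmod hL4
  by_cases h : L ∣ k + 1
  · simp [cyclePoint, Nat.succ_div_of_dvd h, this]
  · simp [cyclePoint, Nat.succ_div_of_not_dvd h, this]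

lemma cyclePoint_mul_self (hL4 : 4 ≤ L) : cyclePoint L (L * L) = cyclePoint L 0 := by
  simp [cyclePoint, Nat.mul_div_cancel _ (show 0 < L by omega)]

lemma cyclePoint_injOn [NeZero L] : Set.InjOn (cyclePoint L) (Set.Iio (L * L)) := by
  intro k hk l hl h
  simp only [cyclePoint, Prod.mk.injEq] at h
  have hdiv : k / L = l / L := by
    have h2 := (ZMod.natCast_eq_natCast_iff' _ _ _).1 h.2
    rwa [Nat.mod_eq_of_lt (Nat.div_lt_of_lt_mul hk),
      Nat.mod_eq_of_lt (Nat.div_lt_of_lt_mul hl)] at h2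
  rw [hdiv] at h
  have hmod := (ZMod.natCast_eq_natCast_iff' _ _ _).1 (sub_left_injective h.1)
  rw [← Nat.div_add_mod k L, ← Nat.div_add_mod l L, hdiv, hmod]

lemma cycleEdge_injOn [NeZero L] : Set.InjOn (cycleEdge L) (Set.Iio (L * L)) := by
  intro k hk l hl h
  apply cyclePoint_injOn hk hl
  unfold cycleEdge at h
  split_ifs at h <;> simpa using h

lemma image_cyclePoint [NeZero L] :
    (Finset.range (L * L)).image (cyclePoint L) = Finset.univ := by
  apply Finset.eq_univ_of_card
  rw [Finset.card_image_of_injOn]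
  · simp
  · simpa [Set.Iio] using cyclePoint_injOn (L := L)

lemma sum_cyclePoint [NeZero L] {M : Type*} [AddCommMonoid M] (f : Vertex L → M) :
    ∑ k ∈ Finset.range (L * L), f (cyclePoint L k) = ∑ v, f v := by
  rw [← image_cyclePoint, Finset.sum_image]
  simpa [Set.Iio] using cyclePoint_injOn (L := L)

/-- The parity of the number of points of `D` among the first `k` points of the cycle. -/
def prefixParity (D : Finset (Vertex L)) (k : ℕ) : ZMod 2 :=
  ∑ m ∈ Finset.range k, if cyclePoint L m ∈ D then 1 else 0

/-- The two joins contained in the Hamiltonian cycle. -/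
def cycleJoin (D : Finset (Vertex L)) (b : ZMod 2) : Finset (Edge L) :=
  ((Finset.range (L * L)).filter fun k => prefixParity D (k + 1) = b).image (cycleEdge L)

/-- Summation by parts over `𝔽₂`; the last two terms are the boundary terms. -/
lemma sum_prefixParity (D : Finset (Vertex L)) (b : ZMod 2) (d : ℕ → ZMod 2) (n : ℕ) :
    ∑ k ∈ Finset.range n, (prefixParity D (k + 1) + b) * (d k + d (k + 1)) =
      (∑ k ∈ Finset.range n, if cyclePoint L k ∈ D then d k else 0) +
        (prefixParity D n + b) * d n + b * d 0 := by
  induction n with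
  | zero => simp [prefixParity, CharTwo.add_self_eq_zero]
  | succ n ih =>
    rw [Finset.sum_range_succ, ih, Finset.sum_range_succ]
    have h : prefixParity D (n + 1) =
        prefixParity D n + if cyclePoint L n ∈ D then 1 else 0 := Finset.sum_range_succ _ _
    rw [h]
    clear ih h
    generalize prefixParity D n = s, d n = x, d (n + 1) = y,
      (∑ k ∈ Finset.range n, if cyclePoint L k ∈ D then d k else 0) = t, d 0 = z
    split_ifs <;> revert s b x y t z <;> decide

lemma prefixParity_mul_self [NeZero L] {D : Finset (Vertex L)} (hD : Even D.card) :
    prefixParity D (L * L) = 0 := by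
  unfold prefixParity
  rw [sum_cyclePoint fun v => if v ∈ D then (1 : ZMod 2) else 0]
  simpa using (ZMod.natCast_eq_zero_iff_even).2 hD

/-- Along the cycle, membership of consecutive edges changes exactly at the points of `D`; since `D`
is even, this is consistent when the cycle closes. -/
lemma isJoin_cycleJoin [NeZero L] (hL4 : 4 ≤ L) {D : Finset (Vertex L)}
    (hD : Even D.card) (b : ZMod 2) : IsJoin D (cycleJoin D b) := by
  intro v
  have hinj : Set.InjOn (cycleEdge L) (Finset.range (L * L) : Set ℕ) := by
    simpa [Set.Iio] using cycleEdge_injOn (L := L)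
  have h1 : (degree (cycleJoin D b) v : ZMod 2) = ∑ k ∈ Finset.range (L * L),
      (prefixParity D (k + 1) + (b + 1)) *
        ((if v = cyclePoint L k then 1 else 0) + if v = cyclePoint L (k + 1) then 1 else 0) := by
    unfold degree cycleJoin
    rw [Finset.card_filter, Nat.cast_sum, Finset.sum_image, Finset.sum_filter]
    · refine Finset.sum_congr rfl fun k _ => ?_
      have hne := cyclePoint_succ_ne hL4 k
      -- The shift `b + 1` turns the condition `a = b` into a linear expression over `𝔽₂`.
      have hp : ∀ a b : ZMod 2, a + (b + 1) = if a = b then 1 else 0 := by decide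
      rw [hp, ends_cycleEdge]
      by_cases h2 : v = cyclePoint L k <;> by_cases h3 : v = cyclePoint L (k + 1) <;> simp_all
    · exact hinj.mono (Finset.coe_subset.2 (Finset.filter_subset _ _))
  rw [h1, sum_prefixParity D (b + 1) fun k => if v = cyclePoint L k then 1 else 0,
    prefixParity_mul_self hD, cyclePoint_mul_self hL4, zero_add, add_assoc,
    CharTwo.add_self_eq_zero, add_zero,
    sum_cyclePoint fun w => if w ∈ D then if v = w then (1 : ZMod 2) else 0 else 0]
  rw [Finset.sum_eq_single v] <;> simp +contextual [eq_comm]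

/-- Every even vertex set has a join with at most as many edges as half the vertices. -/
lemma exists_isJoin_card_le [NeZero L] (hL4 : 4 ≤ L) {D : Finset (Vertex L)}
    (hD : Even D.card) : ∃ K, IsJoin D K ∧ 2 * K.card ≤ L * L := by
  have h : (cycleJoin D 0).card + (cycleJoin D 1).card ≤ L * L := by
    refine (Nat.add_le_add Finset.card_image_le Finset.card_image_le).trans ?_
    rw [← Finset.card_union_of_disjoint]
    · exact (Finset.card_le_card (Finset.union_subset (Finset.filter_subset _ _)
        (Finset.filter_subset _ _))).trans (by simp)
    · rw [Finset.disjoint_filter]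
      intro k _ h0 h1
      simp [h0] at h1
  rcases le_total (cycleJoin D 0).card (cycleJoin D 1).card with h' | h'
  · exact ⟨_, isJoin_cycleJoin hL4 hD 0, by omega⟩
  · exact ⟨_, isJoin_cycleJoin hL4 hD 1, by omega⟩

lemma exists_isMinJoin [NeZero L] (hL4 : 4 ≤ L) {D : Finset (Vertex L)}
    (hD : Even D.card) : ∃ J, IsMinJoin D J := by
  obtain ⟨K, hK, -⟩ := exists_isJoin_card_le hL4 hD
  obtain ⟨J, hJ, hmin⟩ := Set.exists_min_image {J | IsJoin D J} Finset.card (Set.toFinite _) ⟨K, hK⟩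
  exact ⟨J, hJ, hmin⟩

/-- Translation by one column exchanges the two colours. -/
lemma card_colour_class [NeZero L] (hL : Even L) (κ : ZMod 2) :
    2 * (Finset.univ.filter fun v : Vertex L => colour v = κ).card = L * L := by
  have h : (Finset.univ.filter fun v : Vertex L => colour v = κ).card =
      (Finset.univ.filter fun v : Vertex L => ¬ colour v = κ).card := by
    refine Finset.card_equiv ((Equiv.addRight (1 : ZMod L)).prodCongr (Equiv.refl _)) ?_
    rintro ⟨i, j⟩
    simp only [Finset.mem_filter, Finset.mem_univ, true_and, Equiv.prodCongr_apply, Prod.map,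
      Equiv.coe_addRight, Equiv.refl_apply, colour_fst_add_one hL]
    generalize colour (i, j) = a
    revert a κ; decide
  have := Finset.card_filter_add_card_filter_not (s := (Finset.univ : Finset (Vertex L)))
    (fun v => colour v = κ)
  rw [← h] at this
  simp only [Finset.card_univ, Fintype.card_prod, ZMod.card] at this
  omega

/-- Each edge is counted once, at its only end of colour `κ`. -/
lemma sum_degree_colour [NeZero L] (hL : Even L) (J : Finset (Edge L)) (κ : ZMod 2) :
    ∑ v ∈ Finset.univ.filter (fun v : Vertex L => colour v = κ), degree J v = J.card := by
  simp only [degree, Finset.card_filter]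
  rw [Finset.sum_comm, Finset.card_eq_sum_ones]
  refine Finset.sum_congr rfl fun e _ => ?_
  obtain ⟨x, hx, hκ⟩ := exists_mem_ends hL κ e
  rw [Finset.sum_eq_single_of_mem x (by simp [hκ]), if_pos hx]
  intro y hy hne
  rw [if_neg]
  intro hy'
  exact hne (eq_of_mem_ends hL hy' hx (by rw [hκ]; simpa using hy))

end Hamiltonian

/-! ### The walk of an excess and its recurrence -/

section Walk

variable {L : ℕ}

/-- An edge determines its end of a given colour, so only the two corners of `outCell y τ` coloured
like `y` can be `x`. -/
lemma hEdge_mem_sides (hL : Even L) (hL4 : 4 ≤ L) {x y : Vertex L} {σ τ : Bool}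
    (hc : colour x = colour y) (h : hEdge x σ ∈ sides L (outCell y τ)) :
    (x = y ∨ x = target y τ) ∧ σ = τ := by
  have key (z : Vertex L) (hz : colour z = colour y) (h : hEdge x σ = hEdge z τ) :
      x = z ∧ σ = τ := by
    have hxz : x = z :=
      eq_of_mem_ends hL (hEdge_mem x σ) (h ▸ hEdge_mem z τ) (hc.trans hz.symm)
    subst hxz
    exact ⟨rfl, hEdge_inj hL4 h⟩
  rw [sides_outCell hL] at h
  simp only [Finset.mem_insert, Finset.mem_singleton, hEdge_ne_vEdge, false_or, or_false] at h
  rcases h with h | h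
  · exact (key _ rfl h).imp Or.inl id
  · exact (key _ (colour_target hL y τ) h).imp Or.inr id

lemma vEdge_mem_sides (hL : Even L) (hL4 : 4 ≤ L) {x y : Vertex L} {σ τ : Bool}
    (hc : colour x = colour y) (h : vEdge x σ ∈ sides L (outCell y τ)) :
    (x = y ∧ σ = τ) ∨ (x = target y τ ∧ σ = !τ) := by
  have key (z : Vertex L) (ρ : Bool) (hz : colour z = colour y) (h : vEdge x σ = vEdge z ρ) :
      x = z ∧ σ = ρ := by
    have hxz : x = z :=
      eq_of_mem_ends hL (vEdge_mem x σ) (h ▸ vEdge_mem z ρ) (hc.trans hz.symm)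
    subst hxz
    exact ⟨rfl, vEdge_inj hL4 h⟩
  rw [sides_outCell hL] at h
  simp only [Finset.mem_insert, Finset.mem_singleton, (hEdge_ne_vEdge _ _ _ _).symm, false_or] at h
  rcases h with h | h
  · exact Or.inl (key _ _ rfl h)
  · exact Or.inr (key _ _ (colour_target hL y τ) h)

/-- An infinite sequence of flips that carries an excess around the lattice. -/
structure IsWalk (J : ℕ → Finset (Edge L)) (v : ℕ → Vertex L) (τ : ℕ → Bool) : Prop where
  hEdge_mem : ∀ n, hEdge (v n) (τ n) ∈ J n
  vEdge_mem : ∀ n, vEdge (v n) (τ n) ∈ J n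
  flip_eq : ∀ n, J (n + 1) = J n ∆ sides L (outCell (v n) (τ n))
  target_eq : ∀ n, v (n + 1) = target (v n) (τ n)

variable {J : ℕ → Finset (Edge L)} {v : ℕ → Vertex L} {τ : ℕ → Bool}

lemma IsWalk.colour_eq (hL : Even L) (h : IsWalk J v τ) (n : ℕ) : colour (v n) = colour (v 0) := by
  induction n with
  | zero => rfl
  | succ n ih => rw [h.target_eq, colour_target hL, ih]

/-- The flip at time `n` removes the pair. Until the return, a flip elsewhere can touch the pair
only by arriving at `v n`, and an arrival restores at most one of its two edges. -/
lemma IsWalk.pair_of_not_visited (hL : Even L) (hL4 : 4 ≤ L) (h : IsWalk J v τ) (n : ℕ) {k : ℕ}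
    (hk : n + 1 ≤ k) (hvis : ∀ l, n < l → l < k → v l ≠ v n) :
    (hEdge (v n) (τ n) ∈ J k → vEdge (v n) (τ n) ∉ J k) ∧
      (v k ≠ v n → hEdge (v n) (τ n) ∉ J k ∧ vEdge (v n) (τ n) ∉ J k) := by
  induction k, hk using Nat.le_induction with
  | base =>
    have h1 := h.hEdge_mem n
    have h2 := h.vEdge_mem n
    simp [h.flip_eq n, Finset.mem_symmDiff, sides_outCell hL, h1, h2]
  | succ k hk ih =>
    have hne := hvis k hk k.lt_succ_self
    obtain ⟨hh, hv⟩ := (ih fun l hl hl' => hvis l hl (hl'.trans k.lt_succ_self)).2 hne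
    have hc : colour (v n) = colour (v k) := by rw [h.colour_eq hL n, h.colour_eq hL k]
    have hmem (e : Edge L) (he : e ∉ J k) :
        e ∈ J (k + 1) ↔ e ∈ sides L (outCell (v k) (τ k)) := by
      simp [h.flip_eq k, Finset.mem_symmDiff, he]
    rw [hmem _ hh, hmem _ hv, h.target_eq k]
    refine ⟨fun h1 h2 => ?_, fun hne' => ⟨fun h1 => ?_, fun h2 => ?_⟩⟩
    -- Arriving with both edges would force `τ n` to equal both `τ k` and `!τ k`.
    · have h3 := (hEdge_mem_sides hL hL4 hc h1).2
      rcases vEdge_mem_sides hL hL4 hc h2 with h4 | h4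
      · exact hne h4.1.symm
      · simp [h3] at h4
    · rcases (hEdge_mem_sides hL hL4 hc h1).1 with h4 | h4
      · exact hne h4.symm
      · exact hne' h4.symm
    · rcases vEdge_mem_sides hL hL4 hc h2 with h4 | h4
      · exact hne h4.1.symm
      · exact hne' h4.1.symm

/-- The walk leaves a vertex through its two outgoing plaquettes alternately. -/
lemma IsWalk.exits_alternate (hL : Even L) (hL4 : 4 ≤ L) (h : IsWalk J v τ) {n m : ℕ} (hnm : n < m)
    (hm : v m = v n) (hvis : ∀ l, n < l → l < m → v l ≠ v n) : τ m = !τ n := by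
  by_contra hne
  have heq : τ m = τ n := by simpa using hne
  have h1 := h.hEdge_mem m
  have h2 := h.vEdge_mem m
  rw [hm, heq] at h1 h2
  exact (h.pair_of_not_visited hL hL4 n hnm hvis).1 h1 h2

/-- Of two consecutive exits from `x`, one has label `σ`. -/
lemma IsWalk.target_visited (hL : Even L) (hL4 : 4 ≤ L) (h : IsWalk J v τ) {x : Vertex L}
    (hx : ∀ N, ∃ n, N ≤ n ∧ v n = x) (σ : Bool) : ∀ N, ∃ n, N ≤ n ∧ v n = target x σ := by
  intro N
  obtain ⟨n, hn, hnx⟩ := hx N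
  by_cases hσ : τ n = σ
  · exact ⟨n + 1, by omega, by rw [h.target_eq, hnx, hσ]⟩
  have hex : ∃ m, n + 1 ≤ m ∧ v m = x := hx (n + 1)
  obtain ⟨hm1, hm2⟩ := Nat.find_spec hex
  have halt : τ (Nat.find hex) = !τ n := by
    refine h.exits_alternate hL hL4 hm1 (by rw [hm2, hnx]) fun l hl hl' hlx => ?_
    exact Nat.find_min hex hl' ⟨hl, hlx.trans hnx⟩
  refine ⟨Nat.find hex + 1, by omega, ?_⟩
  rw [h.target_eq, hm2, halt]
  congr 1
  revert hσ
  cases τ n <;> cases σ <;> simp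

lemma exists_add_two_mul [NeZero L] {a b : ZMod L} (hL : Even L)
    (h : (a.cast : ZMod 2) = b.cast) : ∃ k : ℕ, b = a + k * 2 := by
  have h0 : ((b - a).cast : ZMod 2) = 0 := by rw [ZMod.cast_sub hL.two_dvd, h, sub_self]
  rw [ZMod.cast_eq_val, ZMod.natCast_eq_zero_iff_even] at h0
  obtain ⟨k, hk⟩ := h0
  refine ⟨k, ?_⟩
  have h1 := ZMod.natCast_zmod_val (b - a)
  rw [hk] at h1
  rw [← sub_eq_iff_eq_add', ← h1]
  push_cast
  ring

/-- A set closed under `target` that contains a vertex contains all vertices of its colour. -/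
lemma mem_of_target_closed [NeZero L] (hL : Even L) {I : Set (Vertex L)}
    (hI : ∀ x ∈ I, ∀ σ, target x σ ∈ I) {x y : Vertex L} (hx : x ∈ I) (h : colour x = colour y) :
    y ∈ I := by
  have hfst : ∀ z ∈ I, ∀ k : ℕ, (z.1 + k * 2, z.2) ∈ I := by
    intro z hz k
    induction k with
    | zero => simpa using hz
    | succ k ih =>
      generalize hi : z.1 + k * 2 = i at ih
      -- Two eastward diagonal steps with opposite vertical directions.
      have h2 := hI _ (hI _ ih (evenCol i)) (!evenCol i)
      have h3 : target (target (i, z.2) (evenCol i)) (!evenCol i) = (i + 2, z.2) := by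
        cases hc : evenCol i <;> simp [target, evenCol_add_one hL, hc] <;> ring
      rw [h3, ← hi] at h2
      convert h2 using 2
      push_cast; ring
  have hsnd : ∀ z ∈ I, ∀ k : ℕ, (z.1, z.2 + k * 2) ∈ I := by
    intro z hz k
    induction k with
    | zero => simpa using hz
    | succ k ih =>
      generalize hj : z.2 + k * 2 = j at ih
      -- Two northward diagonal steps; the column parity changes in between, so the horizontal moves
      -- cancel.
      have h2 := hI _ (hI _ ih true) true
      have h3 : target (target (z.1, j) true) true = (z.1, j + 2) := by
        cases hc : evenCol z.1 <;>
          simp [target, evenCol_add_one hL, evenCol_sub_one hL, hc] <;> ring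
      rw [h3, ← hj] at h2
      convert h2 using 2
      push_cast; ring
  have key : ∀ z ∈ I, colour z = colour y → (z.1.cast : ZMod 2) = y.1.cast → y ∈ I := by
    intro z hz hc h1
    have h2 : (z.2.cast : ZMod 2) = y.2.cast := by
      unfold colour at hc
      rwa [h1, add_right_inj] at hc
    obtain ⟨k, hk⟩ := exists_add_two_mul hL h1
    obtain ⟨l, hl⟩ := exists_add_two_mul hL h2
    have := hsnd _ (hfst z hz k) l
    rwa [← hk, ← hl] at this
  by_cases h1 : (x.1.cast : ZMod 2) = y.1.cast
  · exact key x hx h h1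
  -- One diagonal step corrects the column parity without changing the colour.
  · refine key _ (hI x hx (evenCol x.1)) ((colour_target hL _ _).trans h) ?_
    have hz : ∀ a b : ZMod 2, a ≠ b → a + 1 = b := by decide
    simp [target, ZMod.cast_add hL.two_dvd, ZMod.cast_one (R := ZMod 2) hL.two_dvd, hz _ _ h1]

lemma IsWalk.visits_colour_class [NeZero L] (hL : Even L) (hL4 : 4 ≤ L) (h : IsWalk J v τ)
    {y : Vertex L} (hy : colour y = colour (v 0)) : ∃ n, v n = y := by
  obtain ⟨x, hx⟩ := Finite.exists_infinite_fiber v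
  have hx' : x ∈ {x | ∀ N, ∃ n, N ≤ n ∧ v n = x} := by
    intro N
    obtain ⟨n, hn, hN⟩ := (Set.infinite_coe_iff.1 hx).exists_gt N
    exact ⟨n, hN.le, hn⟩
  have hc : colour x = colour y := by
    obtain ⟨n, -, rfl⟩ := hx' 0
    rw [h.colour_eq hL, hy]
  obtain ⟨n, -, hn⟩ := mem_of_target_closed hL
    (I := {x | ∀ N, ∃ n, N ≤ n ∧ v n = x}) (fun _ hx σ => h.target_visited hL hL4 hx σ) hx' hc 0
  exact ⟨n, hn⟩

end Walk

/-! ### Moving the excess and the final count -/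

section Excess

variable {L : ℕ}

lemma IsJoin.odd_degree {D : Finset (Vertex L)} {J : Finset (Edge L)} (hJ : IsJoin D J)
    {v : Vertex L} (hv : v ∈ D) : Odd (degree J v) := by
  rw [← ZMod.natCast_eq_one_iff_odd, hJ v, if_pos hv]

/-- Without a full pair the degree is at most 2, and being odd it is 1. -/
lemma IsJoin.exists_full_pair {D : Finset (Vertex L)} {J : Finset (Edge L)}
    (hJ : IsJoin D J) {v : Vertex L} (hv : v ∈ D) (hdeg : degree J v ≠ 1) :
    ∃ τ, hEdge v τ ∈ J ∧ vEdge v τ ∈ J := by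
  by_contra! hno
  have key (τ : Bool) : ∃ a, ∀ e ∈ J, e = hEdge v τ ∨ e = vEdge v τ → e = a := by
    by_cases h : hEdge v τ ∈ J
    · refine ⟨hEdge v τ, ?_⟩
      rintro e he (rfl | rfl)
      · rfl
      · exact absurd he (hno τ h)
    · refine ⟨vEdge v τ, ?_⟩
      rintro e he (rfl | rfl)
      · exact absurd he h
      · rfl
  choose a ha using key
  have hle : degree J v ≤ 2 := by
    refine (Finset.card_le_card (t := {a true, a false}) fun e he => ?_).trans Finset.card_le_two
    obtain ⟨he, hve⟩ := Finset.mem_filter.1 he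
    obtain ⟨τ, h⟩ := (mem_ends_iff v e).1 hve
    have := ha τ e he h
    cases τ <;> simp [this]
  have := hJ.odd_degree hv
  interval_cases hd : degree J v
  · simp at this
  · exact hdeg rfl
  · exact absurd this (by decide)

/-- The vertices of `D` of degree greater than one. -/
def excess (D : Finset (Vertex L)) (J : Finset (Edge L)) : Finset (Vertex L) :=
  D.filter fun v => degree J v ≠ 1

lemma mem_excess {D : Finset (Vertex L)} {J : Finset (Edge L)} {v : Vertex L} :
    v ∈ excess D J ↔ v ∈ D ∧ degree J v ≠ 1 := Finset.mem_filter

/-- The degree at `x` falls from 3 to 1, so `x` leaves the excess set and only the target can enter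
it. If the count does not drop, the target must be there. -/
lemma IsMinJoin.excess_flip (hL : Even L) (hL4 : 4 ≤ L) {D : Finset (Vertex L)}
    {J : Finset (Edge L)} (hJ : IsMinJoin D J) {x : Vertex L} {τ : Bool} (hx : x ∈ excess D J)
    (hh : hEdge x τ ∈ J) (hv : vEdge x τ ∈ J) (hd : degree J x ≤ 4)
    (hcard : (excess D J).card ≤ (excess D (J ∆ sides L (outCell x τ))).card) :
    target x τ ∈ excess D (J ∆ sides L (outCell x τ)) ∧
      (excess D (J ∆ sides L (outCell x τ))).card ≤ (excess D J).card := by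
  have hdeg := hJ.degree_flip hL hL4 hh hv
  have ht := target_ne hL4 x τ
  set K := J ∆ sides L (outCell x τ)
  have hxD := (mem_excess.1 hx).1
  have hxK : x ∉ excess D K := by
    have h1 := hdeg x
    have h2 := hJ.1.odd_degree hxD
    rw [if_pos rfl, if_neg ht.symm] at h1
    rw [mem_excess, not_and_not_right]
    intro _
    obtain ⟨k, hk⟩ := h2
    have := (mem_excess.1 hx).2
    omega
  have hsub : ∀ y ∈ excess D K, y = target x τ ∨ y ∈ (excess D J).erase x := by
    intro y hy
    by_cases hyt : y = target x τ
    · exact Or.inl hyt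
    have hyx : y ≠ x := fun h => hxK (h ▸ hy)
    have h1 := hdeg y
    rw [if_neg hyt, if_neg hyx, add_zero, add_zero] at h1
    rw [mem_excess, h1] at hy
    exact Or.inr (Finset.mem_erase.2 ⟨hyx, mem_excess.2 hy⟩)
  have he := Finset.card_erase_add_one hx
  constructor
  · by_contra hnot
    have : excess D K ⊆ (excess D J).erase x := fun y hy =>
      (hsub y hy).resolve_left fun h => hnot (h ▸ hy)
    have := Finset.card_le_card this
    omega
  · have : excess D K ⊆ insert (target x τ) ((excess D J).erase x) := fun y hy =>
      Finset.mem_insert.2 (hsub y hy)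
    exact (Finset.card_le_card this).trans ((Finset.card_insert_le _ _).trans he.le)

lemma degree_le_four (J : Finset (Edge L)) (v : Vertex L) : degree J v ≤ 4 := by
  refine (Finset.card_le_card (t := {hEdge v true, hEdge v false, vEdge v true, vEdge v false})
    fun e he => ?_).trans Finset.card_le_four
  obtain ⟨τ, h⟩ := (mem_ends_iff v e).1 (Finset.mem_filter.1 he).2
  cases τ <;> rcases h with rfl | rfl <;> simp

/-- A nonempty family of minimum joins that is closed under flipping plaquettes contains a join
that has degree one at all prescribed vertices. -/
theorem exists_degree_eq_one [NeZero L] (hL : Even L) (hL4 : 4 ≤ L) {D : Finset (Vertex L)}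
    (hD : Even D.card) {C : Set (Finset (Edge L))} (hne : C.Nonempty)
    (hmin : ∀ J ∈ C, IsMinJoin D J)
    (hflip : ∀ J ∈ C, ∀ p, IsMinJoin D (J ∆ sides L p) → J ∆ sides L p ∈ C) :
    ∃ J ∈ C, ∀ v ∈ D, degree J v = 1 := by
  obtain ⟨J₀, hJ₀, hleast⟩ :=
    Set.exists_min_image C (fun J => (excess D J).card) (Set.toFinite _) hne
  by_contra! hno
  obtain ⟨v₀, hv₀⟩ := hno J₀ hJ₀
  -- A state records a join of least excess count in `C` and one of its excess vertices; leastness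
  -- is what lets every step be repeated.
  let State := {s : Finset (Edge L) × Vertex L //
    (s.1 ∈ C ∧ (excess D s.1).card ≤ (excess D J₀).card) ∧ s.2 ∈ excess D s.1}
  have hstep (s : State) : ∃ τ, ∃ t : State, hEdge s.1.2 τ ∈ s.1.1 ∧ vEdge s.1.2 τ ∈ s.1.1 ∧
      t.1.1 = s.1.1 ∆ sides L (outCell s.1.2 τ) ∧ t.1.2 = target s.1.2 τ := by
    obtain ⟨⟨J, x⟩, ⟨hJ, hle⟩, hx⟩ := s
    have hJm := hmin J hJ
    obtain ⟨τ, hh, hv⟩ := hJm.1.exists_full_pair (mem_excess.1 hx).1 (mem_excess.1 hx).2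
    have hC := hflip J hJ _ (hJm.flip hL hL4 hh hv)
    obtain ⟨h1, h2⟩ := hJm.excess_flip hL hL4 hx hh hv (degree_le_four J x)
      (hle.trans (hleast _ hC))
    exact ⟨τ, ⟨(_, _), ⟨hC, h2.trans hle⟩, h1⟩, hh, hv, rfl, rfl⟩
  choose τ next hh hv hJ ht using hstep
  let s₀ : State := ⟨(J₀, v₀), ⟨hJ₀, le_rfl⟩, mem_excess.2 hv₀⟩
  have hwalk : IsWalk (fun n => (next^[n] s₀).1.1) (fun n => (next^[n] s₀).1.2)
      (fun n => τ (next^[n] s₀)) := by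
    refine ⟨fun n => hh _, fun n => hv _, fun n => ?_, fun n => ?_⟩
    · simp only [Function.iterate_succ_apply', hJ]
    · simp only [Function.iterate_succ_apply', ht]
  have hsub : ∀ y, colour y = colour v₀ → y ∈ D := by
    intro y hy
    obtain ⟨n, rfl⟩ := hwalk.visits_colour_class hL hL4 hy
    exact (mem_excess.1 (next^[n] s₀).2.2).1
  obtain ⟨K, hK, hKle⟩ := exists_isJoin_card_le hL4 hD
  have h1 := (hmin J₀ hJ₀).2 K hK
  have h2 := card_colour_class hL (colour v₀)
  have h3 := sum_degree_colour hL J₀ (colour v₀)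
  have hpos : ∀ y, colour y = colour v₀ → 1 ≤ degree J₀ y := fun y hy =>
    ((hmin J₀ hJ₀).1.odd_degree (hsub y hy)).pos
  -- The inequality is strict because the degree at `v₀` exceeds 1.
  have h4 : (Finset.univ.filter fun v : Vertex L => colour v = colour v₀).card < J₀.card := by
    rw [← h3, Finset.card_eq_sum_ones]
    refine Finset.sum_lt_sum (fun y hy => hpos y (Finset.mem_filter.1 hy).2) ⟨v₀, by simp, ?_⟩
    exact lt_of_le_of_ne (hpos v₀ rfl) hv₀.2.symm
  omega

end Excess

/-! ### Boundaries and transport along lattice isomorphisms -/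

section Transport

lemma boundary_apply {E F : Type*} [Fintype E] [DecidableEq E] [Fintype F] (sd : F → Finset E)
    (c : F → ZMod 2) (e : E) : boundary sd c e = ∑ f, if e ∈ sd f then c f else 0 := by
  simp [boundary, Fintype.linearCombination_apply, Finset.sum_apply, Pi.single_apply]

lemma chainSupport_add {E : Type*} [Fintype E] [DecidableEq E] (x y : E → ZMod 2) :
    chainSupport (x + y) = chainSupport x ∆ chainSupport y := by
  have key : ∀ a b : ZMod 2, a + b ≠ 0 ↔ a ≠ 0 ∧ ¬ b ≠ 0 ∨ b ≠ 0 ∧ ¬ a ≠ 0 := by decide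
  ext e
  simp only [chainSupport, Finset.mem_filter, Finset.mem_univ, true_and, Finset.mem_symmDiff,
    Pi.add_apply, key]

lemma xorBoundary_zero {E F : Type*} [Fintype E] [DecidableEq E] [Fintype F] (sd : F → Finset E)
    (J : Finset E) : xorBoundary sd J 0 = J := by
  have : chainSupport (0 : E → ZMod 2) = ⊥ := by simp [chainSupport]
  rw [xorBoundary, map_zero, this, symmDiff_bot]

/-- Shows that flipping a plaquette stays within the homology class. -/
lemma xorBoundary_symmDiff {E F : Type*} [Fintype E] [DecidableEq E] [Fintype F] [DecidableEq F]
    (sd : F → Finset E) (J : Finset E) (c : F → ZMod 2) (p : F) :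
    xorBoundary sd J c ∆ sd p = xorBoundary sd J (c + Pi.single p 1) := by
  have h : chainSupport (boundary sd (Pi.single p 1)) = sd p := by
    ext e
    simp [chainSupport, boundary_apply, Pi.single_apply, ← ite_and]
    rw [Finset.filter_and]
    simp [Finset.filter_eq']
    by_cases he : e ∈ sd p <;> simp [he]
  rw [xorBoundary, xorBoundary, map_add, chainSupport_add, h, symmDiff_assoc]

lemma map_xorBoundary {E F E' F' : Type*} [Fintype E] [DecidableEq E] [Fintype F] [Fintype E']
    [DecidableEq E'] [Fintype F'] {sd : F → Finset E} {sd' : F' → Finset E'} (ψ : E ≃ E')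
    (χ : F ≃ F') (h : ∀ f e, ψ e ∈ sd' (χ f) ↔ e ∈ sd f) (J : Finset E) (c : F' → ZMod 2) :
    (xorBoundary sd J (c ∘ χ)).map ψ.toEmbedding = xorBoundary sd' (J.map ψ.toEmbedding) c := by
  ext e'
  obtain ⟨e, rfl⟩ := ψ.surjective e'
  have hb : boundary sd' c (ψ e) = boundary sd (c ∘ χ) e := by
    rw [boundary_apply, boundary_apply, ← Equiv.sum_comp χ]
    simp [h]
  simp [xorBoundary, Finset.mem_symmDiff, chainSupport, hb]

variable {L : ℕ} {V E F : Type*}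

/-- The structure of a toric lattice on a graph: an identification with the standard lattice,
including its 2-cells. -/
structure LatticeIso (L : ℕ) (Γ : Graph V E) (sd : F → Finset E) where
  vertex : V ≃ Vertex L
  edge : E ≃ Edge L
  cell : F ≃ Plaquette L
  mem_vertexSet : ∀ v, v ∈ Γ.vertexSet
  mem_edgeSet : ∀ e, e ∈ Γ.edgeSet
  inc_iff : ∀ e v, Γ.Inc e v ↔ vertex v ∈ ends L (edge e)
  mem_sides_iff : ∀ f e, edge e ∈ sides L (cell f) ↔ e ∈ sd f

variable {Γ : Graph V E} {sd : F → Finset E} (ι : LatticeIso L Γ sd)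

lemma LatticeIso.joinDegree_eq (J : Finset E) (v : V) :
    joinDegree Γ J v = degree (J.map ι.edge.toEmbedding) (ι.vertex v) := by
  classical
  have h : {e : E | e ∈ J ∧ Γ.Inc e v} =
      ((J.filter fun e => ι.vertex v ∈ ends L (ι.edge e) : Finset E) : Set E) := by
    ext e; simp [ι.inc_iff]
  rw [joinDegree, h, Set.ncard_coe_finset, degree, Finset.filter_map, Finset.card_map]
  rfl

lemma LatticeIso.isDJoin_iff (D : Finset V) (J : Finset E) :
    IsDJoin Γ D J ↔ IsJoin (D.map ι.vertex.toEmbedding) (J.map ι.edge.toEmbedding) := by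
  have key : ∀ v, (Odd (joinDegree Γ J v) ↔
      (degree (J.map ι.edge.toEmbedding) (ι.vertex v) : ZMod 2) = 1) ∧
      (Even (joinDegree Γ J v) ↔
      (degree (J.map ι.edge.toEmbedding) (ι.vertex v) : ZMod 2) = 0) := fun v => by
    rw [ι.joinDegree_eq, ZMod.natCast_eq_one_iff_odd, ZMod.natCast_eq_zero_iff_even]
    exact ⟨Iff.rfl, Iff.rfl⟩
  constructor
  · rintro ⟨-, h1, h2⟩ w
    obtain ⟨v, rfl⟩ := ι.vertex.surjective w
    by_cases hv : v ∈ D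
    · simpa [hv] using (key v).1.1 (h1 v hv)
    · simpa [hv] using (key v).2.1 (h2 v (ι.mem_vertexSet v) hv)
  · intro h
    refine ⟨fun e _ => ι.mem_edgeSet e, fun v hv => (key v).1.2 ?_, fun v _ hv => (key v).2.2 ?_⟩
    · simpa [hv] using h (ι.vertex v)
    · simpa [hv] using h (ι.vertex v)

lemma LatticeIso.isMinDJoin_iff (D : Finset V) (J : Finset E) :
    IsMinDJoin Γ D J ↔ IsMinJoin (D.map ι.vertex.toEmbedding) (J.map ι.edge.toEmbedding) := by
  unfold IsMinDJoin IsMinJoin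
  rw [ι.isDJoin_iff]
  refine and_congr_right fun _ => ⟨fun h K hK => ?_, fun h K hK => ?_⟩
  · have := h (K.map ι.edge.symm.toEmbedding) (by
      rw [ι.isDJoin_iff, Finset.map_map]; simpa using hK)
    simpa using this
  · simpa using h _ ((ι.isDJoin_iff D K).1 hK)

theorem LatticeIso.exists_homologous [Fintype E] [DecidableEq E] [Fintype F] [NeZero L]
    (ι : LatticeIso L Γ sd) (hL : Even L) (hL4 : 4 ≤ L) {D : Finset V} (hD : Even D.card) {J : Finset E} (hJ : IsMinDJoin Γ D J) :
    ∃ c : F → ZMod 2, IsMinDJoin Γ D (xorBoundary sd J c) ∧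
      (xorBoundary sd J c).card = J.card ∧ ∀ v ∈ D, joinDegree Γ (xorBoundary sd J c) v = 1 := by
  set D' := D.map ι.vertex.toEmbedding
  set J' := J.map ι.edge.toEmbedding
  have hJ' : IsMinJoin D' J' := (ι.isMinDJoin_iff D J).1 hJ
  obtain ⟨_, ⟨hK, c, rfl⟩, hdeg⟩ := exists_degree_eq_one hL hL4 (D := D')
    (C := {K | IsMinJoin D' K ∧ ∃ c, K = xorBoundary (sides L) J' c}) (by simpa [D'] using hD)
    ⟨J', hJ', 0, (xorBoundary_zero _ _).symm⟩ (fun K hK => hK.1) (by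
      rintro _ ⟨-, c, rfl⟩ p hp
      exact ⟨hp, _, xorBoundary_symmDiff _ _ _ _⟩)
  have hmap := map_xorBoundary ι.edge ι.cell ι.mem_sides_iff J c
  have hmin : IsMinDJoin Γ D (xorBoundary sd J (c ∘ ι.cell)) := by
    rw [ι.isMinDJoin_iff, hmap]; exact hK
  -- Both joins are minimum, so their sizes agree.
  refine ⟨c ∘ ι.cell, hmin, le_antisymm (hmin.2 J hJ.1) (hJ.2 _ hmin.1), fun v hv => ?_⟩
  rw [ι.joinDegree_eq, hmap]
  exact hdeg _ (by simpa [D'] using hv)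

theorem LatticeIso.exists_isMinDJoin [NeZero L] (ι : LatticeIso L Γ sd) (hL4 : 4 ≤ L)
    {D : Finset V} (hD : Even D.card) : ∃ J, IsMinDJoin Γ D J := by
  obtain ⟨J, hJ⟩ := exists_isMinJoin hL4 (D := D.map ι.vertex.toEmbedding) (by simpa using hD)
  refine ⟨J.map ι.edge.symm.toEmbedding, ?_⟩
  rw [ι.isMinDJoin_iff, Finset.map_map]
  simpa using hJ

theorem LatticeIso.degree_one_joins [Fintype E] [DecidableEq E] [Fintype F] [NeZero L]
    (ι : LatticeIso L Γ sd) (hL : Even L) (hL4 : 4 ≤ L) (D : Finset V) (hD : Even D.card) :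
    (∃ J : Finset E, IsMinDJoin Γ D J ∧ ∀ v ∈ D, joinDegree Γ J v = 1) ∧
      ∀ J : Finset E, IsMinDJoin Γ D J → ∃ c : F → ZMod 2, IsDJoin Γ D (xorBoundary sd J c) ∧
        (xorBoundary sd J c).card = J.card ∧ ∀ v ∈ D, joinDegree Γ (xorBoundary sd J c) v = 1 := by
  refine ⟨?_, fun J hJ => ?_⟩
  · obtain ⟨J, hJ⟩ := ι.exists_isMinDJoin hL4 hD
    obtain ⟨c, hc, -, hdeg⟩ := ι.exists_homologous hL hL4 hD hJ
    exact ⟨_, hc, hdeg⟩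
  · obtain ⟨c, hc, hcard⟩ := ι.exists_homologous hL hL4 hD hJ
    exact ⟨c, hc.1, hcard⟩

end Transport

/-! ### The lattice and its dual as instances -/

section Lattices

variable {L : ℕ}

lemma exists_ne_mem_ends (hL4 : 4 ≤ L) {e : Edge L} {v : Vertex L} (hv : v ∈ ends L e) :
    ∃ w ∈ ends L e, v ≠ w := by
  have := one_ne_zero_zmod hL4
  obtain ⟨i, j⟩ | ⟨i, j⟩ := e <;> simp only [ends, Finset.mem_insert, Finset.mem_singleton] at hv
  · rcases hv with rfl | rfl
    · exact ⟨(i + 1, j), by simp [ends], by simp [this]⟩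
    · exact ⟨(i, j), by simp [ends], by simp [this]⟩
  · rcases hv with rfl | rfl
    · exact ⟨(i, j + 1), by simp [ends], by simp [this]⟩
    · exact ⟨(i, j), by simp [ends], by simp [this]⟩

lemma ends_nonempty (e : Edge L) : (ends L e).Nonempty := by
  obtain ⟨i, j⟩ | ⟨i, j⟩ := e <;> exact ⟨(i, j), by simp [ends]⟩

lemma lattice_inc_iff (hL4 : 4 ≤ L) (e : Edge L) (v : Vertex L) :
    (lattice L).Inc e v ↔ v ∈ ends L e := by
  refine ⟨fun ⟨w, h⟩ => h.2.1, fun hv => ?_⟩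
  obtain ⟨w, hw, hne⟩ := exists_ne_mem_ends hL4 hv
  exact ⟨w, hne, hv, hw⟩

/-- The lattice with its standard 2-cells. -/
def latticeIso [NeZero L] (hL4 : 4 ≤ L) : LatticeIso L (lattice L) (sides L) where
  vertex := Equiv.refl _
  edge := Equiv.refl _
  cell := Equiv.refl _
  mem_vertexSet _ := Set.mem_univ _
  mem_edgeSet e := by
    obtain ⟨v, hv⟩ := ends_nonempty e
    exact ((lattice_inc_iff hL4 e v).2 hv).edge_mem
  inc_iff := lattice_inc_iff hL4
  mem_sides_iff _ _ := Iff.rfl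

/-- The point reflection of the torus, exchanging horizontal and vertical edges. -/
def edgeReflection (L : ℕ) : Edge L ≃ Edge L :=
  (Equiv.sumComm _ _).trans (Equiv.sumCongr (Equiv.neg _) (Equiv.neg _))

lemma neg_mem_ends_iff (p : Plaquette L) (e : Edge L) :
    -p ∈ ends L (edgeReflection L e) ↔ e ∈ sides L p := by
  obtain ⟨a, b⟩ := p
  obtain ⟨i, j⟩ | ⟨i, j⟩ := e <;>
    simp [ends, sides, edgeReflection] <;> grind

lemma mem_sides_neg_iff (v : Vertex L) (e : Edge L) :
    edgeReflection L e ∈ sides L (-v) ↔ v ∈ ends L e := by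
  obtain ⟨a, b⟩ := v
  obtain ⟨i, j⟩ | ⟨i, j⟩ := e <;>
    simp [ends, sides, edgeReflection] <;> grind

lemma dualLattice_inc_iff (hL4 : 4 ≤ L) (e : Edge L) (p : Plaquette L) :
    (dualLattice L).Inc e p ↔ -p ∈ ends L (edgeReflection L e) := by
  refine ⟨fun ⟨w, h⟩ => (neg_mem_ends_iff p e).2 h.2.1, fun hp => ?_⟩
  obtain ⟨w, hw, hne⟩ := exists_ne_mem_ends hL4 hp
  refine ⟨-w, fun h => hne (by rw [h, neg_neg]), (neg_mem_ends_iff p e).1 hp, ?_⟩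
  rwa [← neg_mem_ends_iff, neg_neg]

/-- The dual lattice, identified with the lattice by a reflection. -/
def dualLatticeIso [NeZero L] (hL4 : 4 ≤ L) : LatticeIso L (dualLattice L) (dualSides L) where
  vertex := Equiv.neg _
  edge := edgeReflection L
  cell := Equiv.neg _
  mem_vertexSet _ := Set.mem_univ _
  mem_edgeSet e := by
    obtain ⟨v, hv⟩ := ends_nonempty (edgeReflection L e)
    rw [← neg_neg v, ← dualLattice_inc_iff hL4] at hv
    exact hv.edge_mem
  inc_iff := dualLattice_inc_iff hL4
  mem_sides_iff v e := by
    simpa [dualSides] using mem_sides_neg_iff v e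

end Lattices

end ToricCode

open ToricCode in
theorem theorem3p1 (L : ℕ) [NeZero L] (hL : Even L) (hL4 : 4 ≤ L) :
    -- the toric code lattice
    (∀ D : Finset (Vertex L), Even D.card →
      (∃ J : Finset (Edge L), IsMinDJoin (lattice L) D J ∧
        ∀ v ∈ D, joinDegree (lattice L) J v = 1) ∧
      ∀ J : Finset (Edge L), IsMinDJoin (lattice L) D J →
        ∃ c : Plaquette L → ZMod 2,
          IsDJoin (lattice L) D (xorBoundary (sides L) J c) ∧
          (xorBoundary (sides L) J c).card = J.card ∧
          ∀ v ∈ D, joinDegree (lattice L) (xorBoundary (sides L) J c) v = 1) ∧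
    -- the dual lattice, whose 2-cells correspond to the vertices of the lattice
    (∀ D : Finset (Plaquette L), Even D.card →
      (∃ J : Finset (Edge L), IsMinDJoin (dualLattice L) D J ∧
        ∀ p ∈ D, joinDegree (dualLattice L) J p = 1) ∧
      ∀ J : Finset (Edge L), IsMinDJoin (dualLattice L) D J →
        ∃ c : Vertex L → ZMod 2,
          IsDJoin (dualLattice L) D (xorBoundary (dualSides L) J c) ∧
          (xorBoundary (dualSides L) J c).card = J.card ∧
          ∀ p ∈ D, joinDegree (dualLattice L) (xorBoundary (dualSides L) J c) p = 1) := by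
  exact ⟨(latticeIso hL4).degree_one_joins hL hL4, (dualLatticeIso hL4).degree_one_joins hL hL4⟩
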